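/- All graphs are finite and simple. A two-terminal series-parallel graph with source $s$ and target $t$ is defined recursively: a single edge $st$ is one; the series composition of such graphs (the target of each is identified with the source of the next one, and the terminals of the result are the first source and the last target) is one; and the parallel composition of such graphs (all sources are identified, and all targets are identified) is one. A series-parallel graph is either a single edge or a two-terminal series-parallel graph together with an additional edge joining its two terminals. A graph is $K_{1,1,3}$-free if it has no (not necessarily induced) subgraph isomorphic to the complete tripartite graph $K_{1,1,3}$. A proper square-contact representation of a graph $G=(V,E)$ assigns to each vertex $v\in V$ an axis-aligned square $S(v)$ of positive side length in the plane such that, for any two distinct vertices $u,v$, the squares $S(u)$ and $S(v)$ have disjoint interiors, they touch if and only if $uv\in E$, and if they touch then they have infinitely many points in common. Theorem. Every $K_{1,1,3}$-free series-parallel graph has a proper square-contact representation. -/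

import Mathlib

/-- `IsTTSP H s t`: the subgraph `H` is a two-terminal series-parallel graph with source `s` and
target `t`. Compositions of `k` graphs are obtained by iterating the compositions of two graphs.
"Identifying" terminals is expressed inside the ambient vertex set: the two parts are subgraphs that
share exactly the identified terminals. -/
inductive IsTTSP {V : Type*} {G : SimpleGraph V} : G.Subgraph → V → V → Prop
  /-- a single edge -/
  | edge {s t : V} (h : G.Adj s t) : IsTTSP (G.subgraphOfAdj h) s t
  /-- series composition: the target of `H₁` is identified with the source of `H₂` -/
  | series {H₁ H₂ : G.Subgraph} {s m t : V} (h₁ : IsTTSP H₁ s m) (h₂ : IsTTSP H₂ m t)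
      (hverts : H₁.verts ∩ H₂.verts = {m}) : IsTTSP (H₁ ⊔ H₂) s t
  /-- parallel composition: sources are identified, and targets are identified; as all graphs are
  simple, the edge between the terminals may be present in at most one of the two parts -/
  | parallel {H₁ H₂ : G.Subgraph} {s t : V} (h₁ : IsTTSP H₁ s t) (h₂ : IsTTSP H₂ s t)
      (hverts : H₁.verts ∩ H₂.verts = {s, t}) (hsimple : ¬ (H₁.Adj s t ∧ H₂.Adj s t)) :
      IsTTSP (H₁ ⊔ H₂) s t

/-- A (simple) series-parallel graph: either a single edge, or a two-terminal series-parallel graph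
together with an additional edge (the reference edge) joining its two terminals. -/
def IsSeriesParallel {V : Type*} (G : SimpleGraph V) : Prop :=
  (∃ (s t : V) (h : G.Adj s t), G.subgraphOfAdj h = ⊤) ∨
  (∃ (s t : V) (h : G.Adj s t) (H : G.Subgraph),
    IsTTSP H s t ∧ ¬ H.Adj s t ∧ H ⊔ G.subgraphOfAdj h = ⊤)

/-- The complete tripartite graph `K_{1,1,3}`. -/
abbrev K113 : SimpleGraph (Σ i : Fin 3, Fin (![1, 1, 3] i)) :=
  SimpleGraph.completeMultipartiteGraph (fun i : Fin 3 => Fin (![1, 1, 3] i))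

/-- An axis-aligned square of positive side length, given by its lower-left corner `(x, y)`. -/
structure AxisSquare where
  x : ℝ
  y : ℝ
  side : ℝ
  side_pos : 0 < side

/-- The closed region of the plane occupied by an axis-aligned square. -/
def AxisSquare.region (Q : AxisSquare) : Set (ℝ × ℝ) :=
  Set.Icc Q.x (Q.x + Q.side) ×ˢ Set.Icc Q.y (Q.y + Q.side)

/-- `S` is a square-contact representation of `G`: the squares of distinct vertices are
interior-disjoint, and they touch if and only if the vertices are adjacent. (For interior-disjoint
squares, a common point always lies on the sides of both.) -/
structure IsSquareContactRep {V : Type*} (G : SimpleGraph V) (S : V → AxisSquare) : Prop where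
  interior_disjoint : ∀ u v : V, u ≠ v →
    Disjoint (interior (S u).region) (interior (S v).region)
  touch_iff_adj : ∀ u v : V, u ≠ v →
    (((S u).region ∩ (S v).region).Nonempty ↔ G.Adj u v)

/-- A square-contact representation is proper if any two touching squares share infinitely many
points. -/
structure IsProperSquareContactRep {V : Type*} (G : SimpleGraph V) (S : V → AxisSquare) : Prop
    extends IsSquareContactRep G S where
  proper : ∀ u v : V, u ≠ v → ((S u).region ∩ (S v).region).Nonempty →
    ((S u).region ∩ (S v).region).Infinite

/-! Adjacent vertices of a `K_{1,1,3}`-free graph have at most two common neighbours. Where a small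
square leans on the side of a large one, each end of the contact segment is the apex of a
right-angled corner, and a common neighbour placed in a corner occupies its apex. So there is room
for exactly two.

The graph is decomposed into networks (`IsNet`), sets of inner vertices between two terminals. The
terminals of a network are modelled by lines, since it can be scaled to be small compared with their
squares. By induction (`IsNet.realizable`) a network fits into the gap between two parallel lines
and, if its terminals are adjacent, into the two corners at their contact, into a single corner if
it contains at most one common neighbour, and into a corner with the apex left free if it contains
none.

Parallel composition stacks networks in a gap or nests them in a corner, at most one of them using
the apex. Series composition places the middle vertex as a fixed square and the two networks beside
it. The critical case is a triangle `s`, `m`, `t`: the square of `m` fills the apex, so each network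
has one corner only, but the third triangle vertex already is a common neighbour outside the
network, so at most one remains inside. -/

/-- A square given by its centre `(x, y)` and half its side length `r`. -/
structure CSquare where
  x : ℝ
  y : ℝ
  r : ℝ

/-- The two squares share a segment of positive length on their sides. -/
def Touches (p q : CSquare) : Prop :=
  (|p.x - q.x| = p.r + q.r ∧ |p.y - q.y| < p.r + q.r) ∨
  (|p.y - q.y| = p.r + q.r ∧ |p.x - q.x| < p.r + q.r)

/-- The two closed squares are disjoint. -/
def Apart (p q : CSquare) : Prop :=
  p.r + q.r < |p.x - q.x| ∨ p.r + q.r < |p.y - q.y|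

/-- The squares touch properly if `a` holds and are disjoint otherwise. -/
def ContactIff (a : Prop) (p q : CSquare) : Prop :=
  (a → Touches p q) ∧ (¬ a → Apart p q)

theorem ContactIff.symm {a b : Prop} {p q : CSquare} (h : ContactIff a p q) (hab : b ↔ a) :
    ContactIff b q p := by
  unfold ContactIff Touches Apart at *
  rw [hab, abs_sub_comm q.x, abs_sub_comm q.y, add_comm q.r]
  exact h

theorem contactIff_of_lt_x {a : Prop} {p q : CSquare} (ha : ¬ a) (h : p.x + p.r < q.x - q.r) :
    ContactIff a p q :=
  ⟨fun h' => absurd h' ha, fun _ => Or.inl (by rw [abs_sub_comm]; exact lt_abs.2 (Or.inl (by linarith)))⟩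

theorem contactIff_of_lt_y {a : Prop} {p q : CSquare} (ha : ¬ a) (h : p.y + p.r < q.y - q.r) :
    ContactIff a p q :=
  ⟨fun h' => absurd h' ha, fun _ => Or.inr (by rw [abs_sub_comm]; exact lt_abs.2 (Or.inl (by linarith)))⟩

/-- `q` lies to the left of `p`, and the vertical range of `p` meets that of `q` properly. -/
theorem contactIff_left {a : Prop} {p q : CSquare} (h : q.x + q.r ≤ p.x - p.r)
    (ha : p.x - p.r = q.x + q.r ↔ a) (hy : |p.y - q.y| < p.r + q.r) : ContactIff a p q := by
  by_cases h' : a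
  · have := ha.2 h'
    refine ⟨fun _ => Or.inl ⟨?_, hy⟩, fun h => absurd h' h⟩
    rw [show p.x - q.x = p.r + q.r by linarith]
    exact abs_of_nonneg (by linarith [abs_nonneg (p.y - q.y)])
  · refine ⟨fun h => absurd h h', fun _ => Or.inl (lt_abs.2 (Or.inl ?_))⟩
    rcases h.lt_or_eq with h | h
    · linarith
    · exact absurd (ha.1 h.symm) h'

/-- Maps of squares that come from similarities of the plane. -/
structure Similarity (f : CSquare → CSquare) : Prop where
  pos : ∀ p, 0 < p.r → 0 < (f p).r
  contact : ∀ a p q, ContactIff a p q → ContactIff a (f p) (f q)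

/-- The map of squares induced by scaling with `c` and `d`, where `|c| = |d|`,
and translating by `(a, b)`. -/
def CSquare.affine (c d a b : ℝ) (p : CSquare) : CSquare := ⟨c * p.x + a, d * p.y + b, |c| * p.r⟩

def CSquare.swap (p : CSquare) : CSquare := ⟨p.y, p.x, p.r⟩

theorem similarity_affine {c d : ℝ} (a b : ℝ) (hc : c ≠ 0) (hd : |d| = |c|) :
    Similarity (CSquare.affine c d a b) := by
  have hc' : 0 < |c| := abs_pos.2 hc
  refine ⟨fun p hp => mul_pos hc' hp, fun P p q h => ?_⟩
  have hx : |c * p.x + a - (c * q.x + a)| = |c| * |p.x - q.x| := by rw [← abs_mul]; ring_nf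
  have hy : |d * p.y + b - (d * q.y + b)| = |c| * |p.y - q.y| := by
    rw [← hd, ← abs_mul]; ring_nf
  unfold ContactIff Touches Apart CSquare.affine at *
  dsimp only
  rw [hx, hy, ← mul_add, mul_right_inj' hc'.ne', mul_right_inj' hc'.ne',
    mul_lt_mul_iff_right₀ hc', mul_lt_mul_iff_right₀ hc', mul_lt_mul_iff_right₀ hc',
    mul_lt_mul_iff_right₀ hc']
  exact h

theorem similarity_swap : Similarity CSquare.swap := by
  refine ⟨fun p hp => hp, fun P p q h => ?_⟩
  unfold ContactIff Touches Apart CSquare.swap at *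
  exact ⟨fun ha => (h.1 ha).symm, fun ha => (h.2 ha).symm⟩

/-! ### Realizations in gaps and corners -/

section Nets

variable {V : Type*} {G : SimpleGraph V}

/-- The subgraph of `G` induced by `I` can be realized by squares each of which satisfies `Q`. -/
def Realizable (G : SimpleGraph V) (I : Finset V) (Q : V → CSquare → Prop) : Prop :=
  ∃ S : V → CSquare, (∀ w ∈ I, 0 < (S w).r ∧ Q w (S w)) ∧
    ∀ w ∈ I, ∀ z ∈ I, w ≠ z → ContactIff (G.Adj w z) (S w) (S z)

theorem realizable_empty (Q : V → CSquare → Prop) : Realizable G ∅ Q :=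
  ⟨fun _ => ⟨0, 0, 0⟩, by simp, by simp⟩

theorem realizable_singleton {Q : V → CSquare → Prop} {m : V} (p : CSquare) (hp : 0 < p.r)
    (hQ : Q m p) : Realizable G {m} Q :=
  ⟨fun _ => p, by simp [hp, hQ], by simp⟩

theorem Realizable.map {A : Finset V} {Q Q' : V → CSquare → Prop} (h : Realizable G A Q)
    {f : CSquare → CSquare} (hf : Similarity f)
    (hQ : ∀ w ∈ A, ∀ p, 0 < p.r → Q w p → Q' w (f p)) : Realizable G A Q' := by
  obtain ⟨S, hS, hS'⟩ := h
  exact ⟨fun w => f (S w), fun w hw => ⟨hf.pos _ (hS w hw).1, hQ w hw _ (hS w hw).1 (hS w hw).2⟩,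
    fun w hw z hz hwz => hf.contact _ _ _ (hS' w hw z hz hwz)⟩

/-- The square lies in `[0, W] × [-K, K]`, touching the line `x = 0` or `x = W` as prescribed by
the adjacency to `u` or `v`. -/
def InGap (G : SimpleGraph V) (u v : V) (W K : ℝ) (w : V) (p : CSquare) : Prop :=
  p.r ≤ p.x ∧ p.x + p.r ≤ W ∧ |p.y| + p.r ≤ K ∧ (p.x = p.r ↔ G.Adj w u) ∧
    (p.x + p.r = W ↔ G.Adj w v)

/-- The square lies in `[0, R] × [0, R]`, touching the lines `x = 0` and `y = 0` as prescribed by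
the adjacency to `u` and `v`. -/
def InCorner (G : SimpleGraph V) (u v : V) (R : ℝ) (w : V) (p : CSquare) : Prop :=
  p.r ≤ p.x ∧ p.x + p.r ≤ R ∧ p.r ≤ p.y ∧ p.y + p.r ≤ R ∧ (p.x = p.r ↔ G.Adj w u) ∧
    (p.y = p.r ↔ G.Adj w v)

def GapRealizable (G : SimpleGraph V) (I : Finset V) (u v : V) : Prop :=
  ∃ W K : ℝ, 0 < W ∧ 0 < K ∧ Realizable G I (InGap G u v W K)

/-- A square touching both lines contains the apex, so by disjointness a corner holds at most one
common neighbour of `u` and `v`. -/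
def CornerRealizable (G : SimpleGraph V) (I : Finset V) (u v : V) : Prop :=
  ∃ R : ℝ, 0 < R ∧ Realizable G I (InCorner G u v R)

/-- Realizability in a corner such that a neighbourhood of the apex remains free. -/
def OuterCornerRealizable (G : SimpleGraph V) (I : Finset V) (u v : V) : Prop :=
  ∃ R e : ℝ, 0 < R ∧ 0 < e ∧
    Realizable G I (fun w p => InCorner G u v R w p ∧ (e < p.x - p.r ∨ e < p.y - p.r))

/-- The ratio `K` of height to width survives scaling, so a narrow gap needs only a short stretch of
the lines. -/
theorem GapRealizable.scale {I : Finset V} {u v : V} (h : GapRealizable G I u v) :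
    ∃ K, 0 < K ∧ ∀ W, 0 < W → Realizable G I (InGap G u v W (K * W)) := by
  obtain ⟨W₀, K, hW₀, hK, h⟩ := h
  refine ⟨K / W₀, by positivity, fun W hW => ?_⟩
  have hc : 0 < W / W₀ := by positivity
  refine h.map (similarity_affine (c := W / W₀) (d := W / W₀) 0 0 hc.ne' rfl) ?_
  rintro w - p hp ⟨h1, h2, h3, h4, h5⟩
  have e : W / W₀ * W₀ = W := by field_simp
  have e' : K / W₀ * W = W / W₀ * K := by field_simp
  unfold InGap CSquare.affine
  dsimp only
  rw [e', abs_of_pos hc, add_zero, add_zero, abs_mul, abs_of_pos hc, ← mul_add, ← mul_add,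
    ← h4, ← h5]
  refine ⟨by gcongr, (mul_le_mul_of_nonneg_left h2 hc.le).trans_eq e, by gcongr,
    mul_right_inj' hc.ne', ?_⟩
  rw [← mul_right_inj' hc.ne' (b := p.x + p.r), e]

theorem CornerRealizable.scale {I : Finset V} {u v : V} (h : CornerRealizable G I u v)
    {R : ℝ} (hR : 0 < R) : Realizable G I (InCorner G u v R) := by
  obtain ⟨R₀, hR₀, h⟩ := h
  have hc : 0 < R / R₀ := by positivity
  refine h.map (similarity_affine (c := R / R₀) (d := R / R₀) 0 0 hc.ne' rfl) ?_
  rintro w - p hp ⟨h1, h2, h3, h4, h5, h6⟩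
  have e : R / R₀ * R₀ = R := by field_simp
  unfold InCorner CSquare.affine
  dsimp only
  rw [abs_of_pos hc, add_zero, add_zero, ← mul_add, ← mul_add, ← h5, ← h6]
  exact ⟨by gcongr, (mul_le_mul_of_nonneg_left h2 hc.le).trans_eq e, by gcongr,
    (mul_le_mul_of_nonneg_left h4 hc.le).trans_eq e, mul_right_inj' hc.ne', mul_right_inj' hc.ne'⟩

theorem GapRealizable.symm {I : Finset V} {u v : V} (h : GapRealizable G I u v) :
    GapRealizable G I v u := by
  obtain ⟨W, K, hW, hK, h⟩ := h
  refine ⟨W, K, hW, hK, h.map (similarity_affine (c := -1) (d := 1) W 0 (by simp) (by simp)) ?_⟩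
  rintro w - p hp ⟨h1, h2, h3, h4, h5⟩
  simp only [InGap, CSquare.affine, abs_neg, abs_one, one_mul, add_zero, neg_mul, ← h4, ← h5]
  refine ⟨by linarith, by linarith, h3, ?_, ?_⟩ <;> constructor <;> intro <;> linarith

theorem CornerRealizable.symm {I : Finset V} {u v : V} (h : CornerRealizable G I u v) :
    CornerRealizable G I v u := by
  obtain ⟨R, hR, h⟩ := h
  refine ⟨R, hR, h.map similarity_swap ?_⟩
  rintro w - p hp ⟨h1, h2, h3, h4, h5, h6⟩
  exact ⟨h3, h4, h1, h2, h6, h5⟩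

theorem OuterCornerRealizable.symm {I : Finset V} {u v : V} (h : OuterCornerRealizable G I u v) :
    OuterCornerRealizable G I v u := by
  obtain ⟨R, e, hR, he, h⟩ := h
  refine ⟨R, e, hR, he, h.map similarity_swap ?_⟩
  rintro w - p hp ⟨⟨h1, h2, h3, h4, h5, h6⟩, h7⟩
  exact ⟨⟨h3, h4, h1, h2, h6, h5⟩, h7.symm⟩

theorem OuterCornerRealizable.corner {I : Finset V} {u v : V}
    (h : OuterCornerRealizable G I u v) : CornerRealizable G I u v := by
  obtain ⟨R, e, hR, -, S, hS, hS'⟩ := h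
  exact ⟨R, hR, S, fun w hw => ⟨(hS w hw).1, (hS w hw).2.1⟩, hS'⟩

/-- The square lies in `[0, d] × [-K, K]`, touching the line `x = 0` as prescribed by the adjacency
to `u`, and touching the square with centre `(e + 1, 0)` and side length `2` as prescribed by
the adjacency to `m`. -/
def AtSide (G : SimpleGraph V) (u m : V) (e d K : ℝ) (w : V) (p : CSquare) : Prop :=
  p.r ≤ p.x ∧ p.x + p.r ≤ d ∧ |p.y| + p.r ≤ K ∧ (p.x = p.r ↔ G.Adj w u) ∧
    ContactIff (G.Adj w m) p ⟨e + 1, 0, 1⟩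

/-- The gap width `e` is at most `1 / (2 * K)`, so the network has height at most `1 / 2` around the
axis and sees the side of the square as a full line. -/
theorem GapRealizable.atSide {I : Finset V} {u m : V} (h : GapRealizable G I u m) {d : ℝ}
    (hd : 0 < d) : ∃ e, 0 < e ∧ e ≤ d ∧ Realizable G I (AtSide G u m e e (1 / 2)) := by
  obtain ⟨K, hK, h⟩ := h.scale
  refine ⟨min d (1 / (2 * K)), by positivity, min_le_left _ _, ?_⟩
  set e := min d (1 / (2 * K)) with he
  have he0 : 0 < e := by positivity
  have heK : K * e ≤ 1 / 2 := by
    calc K * e ≤ K * (1 / (2 * K)) := by gcongr; exact min_le_right _ _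
      _ = 1 / 2 := by field_simp
  obtain ⟨S, hS, hS'⟩ := h e he0
  refine ⟨S, fun w hw => ⟨(hS w hw).1, ?_⟩, hS'⟩
  obtain ⟨hp, h1, h2, h3, h4, h5⟩ := hS w hw
  refine ⟨h1, h2, by linarith, h4, (contactIff_left (a := G.Adj w m) ?_ ?_ ?_).symm Iff.rfl⟩
  · dsimp only; linarith
  · dsimp only; rw [← h5]; constructor <;> intro <;> linarith
  · dsimp only; rw [zero_sub, abs_neg]; linarith

variable [DecidableEq V]

/-- Realizability in the two corners at the ends of a contact segment. -/
def TwoCornerRealizable (G : SimpleGraph V) (I : Finset V) (u v : V) : Prop :=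
  ∃ A B : Finset V, A ∪ B = I ∧ Disjoint A B ∧ (∀ a ∈ A, ∀ b ∈ B, ¬ G.Adj a b) ∧
    CornerRealizable G A u v ∧ CornerRealizable G B u v

theorem TwoCornerRealizable.symm {I : Finset V} {u v : V} (h : TwoCornerRealizable G I u v) :
    TwoCornerRealizable G I v u := by
  obtain ⟨A, B, h1, h2, h3, hA, hB⟩ := h
  exact ⟨A, B, h1, h2, h3, hA.symm, hB.symm⟩

/-! ### Parallel compositions -/

theorem Realizable.union {A B : Finset V} {Q₁ Q₂ Q : V → CSquare → Prop}
    (h₁ : Realizable G A Q₁) (h₂ : Realizable G B Q₂) (hd : Disjoint A B)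
    (hc : ∀ w ∈ A, ∀ z ∈ B, ∀ p q, 0 < p.r → 0 < q.r → Q₁ w p → Q₂ z q →
      ContactIff (G.Adj w z) p q)
    (hQ₁ : ∀ w ∈ A, ∀ p, 0 < p.r → Q₁ w p → Q w p)
    (hQ₂ : ∀ w ∈ B, ∀ p, 0 < p.r → Q₂ w p → Q w p) : Realizable G (A ∪ B) Q := by
  obtain ⟨S, hS, hS'⟩ := h₁
  obtain ⟨T, hT, hT'⟩ := h₂
  have e₁ : ∀ w ∈ A, A.piecewise S T w = S w := fun w hw => Finset.piecewise_eq_of_mem _ _ _ hw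
  have e₂ : ∀ w ∈ B, A.piecewise S T w = T w := fun w hw =>
    Finset.piecewise_eq_of_notMem _ _ _ (Finset.disjoint_right.1 hd hw)
  refine ⟨A.piecewise S T, fun w hw => ?_, fun w hw z hz hwz => ?_⟩
  · rcases Finset.mem_union.1 hw with hw | hw
    · rw [e₁ w hw]; exact ⟨(hS w hw).1, hQ₁ w hw _ (hS w hw).1 (hS w hw).2⟩
    · rw [e₂ w hw]; exact ⟨(hT w hw).1, hQ₂ w hw _ (hT w hw).1 (hT w hw).2⟩
  · rcases Finset.mem_union.1 hw with hw | hw <;> rcases Finset.mem_union.1 hz with hz | hz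
    · rw [e₁ w hw, e₁ z hz]; exact hS' w hw z hz hwz
    · rw [e₁ w hw, e₂ z hz]
      exact hc w hw z hz _ _ (hS w hw).1 (hT z hz).1 (hS w hw).2 (hT z hz).2
    · rw [e₂ w hw, e₁ z hz]
      exact (hc z hz w hw _ _ (hS z hz).1 (hT w hw).1 (hS z hz).2 (hT w hw).2).symm
        (G.adj_comm _ _)
    · rw [e₂ w hw, e₂ z hz]; exact hT' w hw z hz hwz

/-- `A` is shrunk into the square of side `e` at the apex that `B` leaves free. -/
theorem CornerRealizable.union {A B : Finset V} {u v : V} (hA : CornerRealizable G A u v)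
    (hB : OuterCornerRealizable G B u v) (hd : Disjoint A B)
    (hAB : ∀ a ∈ A, ∀ b ∈ B, ¬ G.Adj a b) : CornerRealizable G (A ∪ B) u v := by
  obtain ⟨R, e, hR, he, hB⟩ := hB
  refine ⟨R + e, by positivity, (hA.scale he).union hB hd ?_ ?_ ?_⟩
  · rintro w hw z hz p q hp hq ⟨h1, h2, h3, h4, h5, h6⟩ ⟨-, h | h⟩
    · exact contactIff_of_lt_x (hAB w hw z hz) (by linarith)
    · exact contactIff_of_lt_y (hAB w hw z hz) (by linarith)
  · rintro w hw p hp ⟨h1, h2, h3, h4, h5, h6⟩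
    exact ⟨h1, by linarith, h3, by linarith, h5, h6⟩
  · rintro w hw p hp ⟨⟨h1, h2, h3, h4, h5, h6⟩, -⟩
    exact ⟨h1, by linarith, h3, by linarith, h5, h6⟩

theorem OuterCornerRealizable.union {A B : Finset V} {u v : V}
    (hA : OuterCornerRealizable G A u v) (hB : OuterCornerRealizable G B u v) (hd : Disjoint A B)
    (hAB : ∀ a ∈ A, ∀ b ∈ B, ¬ G.Adj a b) : OuterCornerRealizable G (A ∪ B) u v := by
  obtain ⟨R, e, hR, he, hB⟩ := hB
  obtain ⟨R₀, e₀, hR₀, he₀, hA⟩ := hA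
  -- This factor shrinks `A` into the free square of side `e`; its own free neighbourhood shrinks
  -- along and serves the union.
  have hc : 0 < e / R₀ := by positivity
  have hcR : e / R₀ * R₀ = e := by field_simp
  have hA' : Realizable G A (fun w p => InCorner G u v e w p ∧
      (e / R₀ * e₀ < p.x - p.r ∨ e / R₀ * e₀ < p.y - p.r)) := by
    refine hA.map (similarity_affine (c := e / R₀) (d := e / R₀) 0 0 hc.ne' rfl) ?_
    rintro w - p hp ⟨⟨h1, h2, h3, h4, h5, h6⟩, h7⟩
    unfold InCorner CSquare.affine
    dsimp only
    rw [abs_of_pos hc, add_zero, add_zero, ← mul_add, ← mul_add, ← mul_sub, ← mul_sub, ← h5, ← h6,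
      mul_lt_mul_iff_right₀ hc, mul_lt_mul_iff_right₀ hc]
    exact ⟨⟨by gcongr, (mul_le_mul_of_nonneg_left h2 hc.le).trans_eq hcR, by gcongr,
      (mul_le_mul_of_nonneg_left h4 hc.le).trans_eq hcR, mul_right_inj' hc.ne',
      mul_right_inj' hc.ne'⟩, h7⟩
  have hm₁ := min_le_left e (e / R₀ * e₀)
  have hm₂ := min_le_right e (e / R₀ * e₀)
  refine ⟨R + e, min e (e / R₀ * e₀), by positivity, by positivity, hA'.union hB hd ?_ ?_ ?_⟩
  · rintro w hw z hz p q hp hq ⟨⟨h1, h2, h3, h4, h5, h6⟩, -⟩ ⟨-, h | h⟩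
    · exact contactIff_of_lt_x (hAB w hw z hz) (by linarith)
    · exact contactIff_of_lt_y (hAB w hw z hz) (by linarith)
  · rintro w hw p hp ⟨⟨h1, h2, h3, h4, h5, h6⟩, h7⟩
    exact ⟨⟨h1, by linarith, h3, by linarith, h5, h6⟩, h7.imp (by intro; linarith)
      (by intro; linarith)⟩
  · rintro w hw p hp ⟨⟨h1, h2, h3, h4, h5, h6⟩, h7⟩
    exact ⟨⟨h1, by linarith, h3, by linarith, h5, h6⟩, h7.imp (by intro; linarith)
      (by intro; linarith)⟩

theorem GapRealizable.union {A B : Finset V} {u v : V} (hA : GapRealizable G A u v)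
    (hB : GapRealizable G B u v) (hd : Disjoint A B)
    (hAB : ∀ a ∈ A, ∀ b ∈ B, ¬ G.Adj a b) : GapRealizable G (A ∪ B) u v := by
  obtain ⟨K, hK, hA⟩ := hA.scale
  obtain ⟨L, hL, hB⟩ := hB.scale
  -- The two networks are pushed to opposite sides of the line `y = 0`.
  have hA' : Realizable G A (fun w p => InGap G u v 1 (2 * K + 1) w p ∧ p.y + p.r < 0) := by
    refine (hA 1 one_pos).map (similarity_affine (c := 1) (d := 1) 0 (-(K + 1)) (by simp) rfl) ?_
    rintro w - p hp ⟨h1, h2, h3, h4, h5⟩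
    have := abs_le.1 (show |p.y| ≤ K - p.r by linarith)
    simp only [InGap, CSquare.affine, abs_one, one_mul, add_zero]
    have : |p.y + -(K + 1)| ≤ 2 * K + 1 - p.r := abs_le.2 ⟨by linarith, by linarith⟩
    exact ⟨⟨h1, h2, by linarith, h4, h5⟩, by linarith⟩
  have hB' : Realizable G B (fun w p => InGap G u v 1 (2 * L + 1) w p ∧ 0 < p.y - p.r) := by
    refine (hB 1 one_pos).map (similarity_affine (c := 1) (d := 1) 0 (L + 1) (by simp) rfl) ?_
    rintro w - p hp ⟨h1, h2, h3, h4, h5⟩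
    have := abs_le.1 (show |p.y| ≤ L - p.r by linarith)
    simp only [InGap, CSquare.affine, abs_one, one_mul, add_zero]
    have : |p.y + (L + 1)| ≤ 2 * L + 1 - p.r := abs_le.2 ⟨by linarith, by linarith⟩
    exact ⟨⟨h1, h2, by linarith, h4, h5⟩, by linarith⟩
  refine ⟨1, 2 * K + 2 * L + 1, one_pos, by positivity, hA'.union hB' hd ?_ ?_ ?_⟩
  · rintro w hw z hz p q hp hq ⟨-, h1⟩ ⟨-, h2⟩
    exact contactIff_of_lt_y (hAB w hw z hz) (by linarith)
  · rintro w hw p hp ⟨⟨h1, h2, h3, h4, h5⟩, -⟩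
    exact ⟨h1, h2, by linarith, h4, h5⟩
  · rintro w hw p hp ⟨⟨h1, h2, h3, h4, h5⟩, -⟩
    exact ⟨h1, h2, by linarith, h4, h5⟩

/-! ### Series compositions -/

/-- The square of `m` leans on the line `x = 0`; the contact ends at `(0, 1)` and `(0, -1)`, and the
corner there is filled by `A` and by the reflected `B`. -/
theorem TwoCornerRealizable.atSide {I : Finset V} {u m : V} (h : TwoCornerRealizable G I u m)
    {d : ℝ} (hd : 0 < d) (hd1 : d ≤ 1) : Realizable G I (AtSide G u m 0 d (1 + d)) := by
  obtain ⟨A, B, rfl, hAB, hadj, hA, hB⟩ := h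
  have hA' : Realizable G A (fun w p => AtSide G u m 0 d (1 + d) w p ∧ 1 ≤ p.y - p.r) := by
    refine (hA.scale hd).map (similarity_affine (c := 1) (d := 1) 0 1 (by simp) rfl) ?_
    rintro w - p hp ⟨h1, h2, h3, h4, h5, h6⟩
    simp only [AtSide, CSquare.affine, abs_one, one_mul, add_zero]
    refine ⟨⟨h1, h2, ?_, h5, ?_⟩, by linarith⟩
    · rw [abs_of_nonneg (by linarith)]; linarith
    -- Exchanging the coordinates turns contact from above into contact from the side.
    · refine similarity_swap.contact _ ⟨p.y + 1, p.x, p.r⟩ ⟨0, 0 + 1, 1⟩ (contactIff_left ?_ ?_ ?_)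
      · dsimp only; linarith
      · dsimp only; rw [← h6]; constructor <;> intro <;> linarith
      · dsimp only; exact abs_lt.2 ⟨by linarith, by linarith⟩
  have hB' : Realizable G B (fun w p => AtSide G u m 0 d (1 + d) w p ∧ p.y + p.r ≤ -1) := by
    refine (hB.scale hd).map (similarity_affine (c := 1) (d := -1) 0 (-1) (by simp) (by simp)) ?_
    rintro w - p hp ⟨h1, h2, h3, h4, h5, h6⟩
    simp only [AtSide, CSquare.affine, abs_one, one_mul, add_zero]
    refine ⟨⟨h1, h2, ?_, h5, ?_⟩, by linarith⟩
    · rw [abs_of_nonpos (by linarith)]; linarith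
    · refine similarity_swap.contact _ ⟨-1 * p.y + -1, p.x, p.r⟩ ⟨0, 0 + 1, 1⟩
        ((contactIff_left (a := G.Adj w m) ?_ ?_ ?_).symm Iff.rfl)
      · dsimp only; linarith
      · dsimp only; rw [← h6]; constructor <;> intro <;> linarith
      · dsimp only; exact abs_lt.2 ⟨by linarith, by linarith⟩
  refine hA'.union hB' hAB ?_ ?_ ?_
  · rintro w hw z hz p q hp hq ⟨-, h1⟩ ⟨-, h2⟩
    exact (contactIff_of_lt_y (a := G.Adj z w) (fun h => hadj w hw z hz h.symm)
      (by linarith)).symm (G.adj_comm _ _)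
  · exact fun w hw p hp h => h.1
  · exact fun w hw p hp h => h.1

/-- A network between `u` and `m` fits between the line `x = 0` and a square whose distance
from this line is zero if and only if `u` and `m` are adjacent. -/
theorem exists_atSide {I : Finset V} {u m : V} (hgap : GapRealizable G I u m)
    (htwo : G.Adj u m → TwoCornerRealizable G I u m) {d : ℝ} (hd : 0 < d) (hd1 : d ≤ 1) :
    ∃ e, 0 ≤ e ∧ e ≤ d ∧ (e = 0 ↔ G.Adj u m) ∧ Realizable G I (AtSide G u m e d (1 + d)) := by
  by_cases h : G.Adj u m
  · exact ⟨0, le_rfl, hd.le, by simp [h], (htwo h).atSide hd hd1⟩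
  · obtain ⟨e, he, hed, S, hS, hS'⟩ := hgap.atSide hd
    refine ⟨e, he.le, hed, by simp [h, he.ne'], S, fun w hw => ⟨(hS w hw).1, ?_⟩, hS'⟩
    obtain ⟨hp, h1, h2, h3, h4, h5⟩ := hS w hw
    exact ⟨h1, by linarith, by linarith, h4, h5⟩

/-- Placing the middle vertex and two networks of a series composition. -/
theorem Realizable.series {A B : Finset V} {m : V} {Q₁ Q₂ Q : V → CSquare → Prop} {p : CSquare}
    (hA : Realizable G A Q₁) (hB : Realizable G B Q₂) (hd : Disjoint A B) (hmA : m ∉ A)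
    (hmB : m ∉ B) (hAB : ∀ a ∈ A, ∀ b ∈ B, ∀ q q', 0 < q.r → 0 < q'.r → Q₁ a q → Q₂ b q' →
      ContactIff (G.Adj a b) q q') (hp : 0 < p.r)
    (hQ₁ : ∀ w ∈ A, ∀ q, 0 < q.r → Q₁ w q → Q w q ∧ ContactIff (G.Adj w m) q p)
    (hQ₂ : ∀ w ∈ B, ∀ q, 0 < q.r → Q₂ w q → Q w q ∧ ContactIff (G.Adj w m) q p) (hQ : Q m p) :
    Realizable G (insert m (A ∪ B)) Q := by
  rw [Finset.insert_eq]
  refine (realizable_singleton (Q := fun _ q => q = p) p hp rfl).union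
    (hA.union hB (Q := fun w q => Q w q ∧ ContactIff (G.Adj w m) q p) hd hAB hQ₁ hQ₂) ?_ ?_ ?_ ?_
  · simp [hmA, hmB]
  · rintro w hw z hz q q' hq hq' rfl ⟨-, h⟩
    rw [Finset.mem_singleton.1 hw]
    exact h.symm (G.adj_comm _ _)
  · rintro w hw q hq rfl
    rw [Finset.mem_singleton.1 hw]
    exact hQ
  · exact fun w hw q hq h => h.1

theorem gapRealizable_series {A B : Finset V} {s m t : V} (hd : Disjoint A B) (hmA : m ∉ A)
    (hmB : m ∉ B) (hAB : ∀ a ∈ A, ∀ b ∈ B, ¬ G.Adj a b) (hAt : ∀ a ∈ A, ¬ G.Adj a t)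
    (hBs : ∀ b ∈ B, ¬ G.Adj b s) (hA : GapRealizable G A s m)
    (hA' : G.Adj s m → TwoCornerRealizable G A s m) (hB : GapRealizable G B t m)
    (hB' : G.Adj t m → TwoCornerRealizable G B t m) :
    GapRealizable G (insert m (A ∪ B)) s t := by
  -- Width `1 / 2` separates the networks: `A` stays in `x ≤ 1 / 2`, the reflected `B` in `x ≥ 3 /
  -- 2`. The reflection maps the square of `m` at distance `f` from its line to the one at distance
  -- `e` from the other line.
  obtain ⟨e, he, he', hes, hA⟩ := exists_atSide hA hA' (d := 1 / 2) (by norm_num) (by norm_num)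
  obtain ⟨f, hf, hf', hft, hB⟩ := exists_atSide hB hB' (d := 1 / 2) (by norm_num) (by norm_num)
  have hB2 : Realizable G B (fun w p => 3 / 2 ≤ p.x - p.r ∧ InGap G s t (2 + e + f) 2 w p ∧
      ContactIff (G.Adj w m) p ⟨e + 1, 0, 1⟩) := by
    have hsim := similarity_affine (c := -1) (d := 1) (2 + e + f) 0 (by simp) (by simp)
    refine hB.map hsim ?_
    rintro w hw p hp ⟨h1, h2, h3, h4, h5⟩
    have := hsim.contact _ _ _ h5
    simp only [InGap, CSquare.affine, abs_neg, abs_one, one_mul, add_zero, neg_mul] at this ⊢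
    refine ⟨by linarith, ⟨by linarith, by linarith, by linarith, ?_, ?_⟩, ?_⟩
    · simp only [hBs w hw, iff_false]; intro; linarith
    · rw [← h4]; constructor <;> intro <;> linarith
    · convert this using 2; ring
  refine ⟨2 + e + f, 2, by positivity, two_pos, hA.series hB2 (p := ⟨e + 1, 0, 1⟩)
    hd hmA hmB ?_ one_pos ?_ ?_ ?_⟩
  · rintro a ha b hb p q hp hq ⟨h1, h2, h3, h4, h5⟩ ⟨h6, -⟩
    exact contactIff_of_lt_x (hAB a ha b hb) (by linarith)
  · rintro w hw p hp ⟨h1, h2, h3, h4, h5⟩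
    refine ⟨⟨h1, by linarith, by linarith, h4, ?_⟩, h5⟩
    simp only [hAt w hw, iff_false]; intro; linarith
  · exact fun w hw p hp h => h.2
  · refine ⟨by simpa, by dsimp only; linarith, by norm_num, ?_, ?_⟩
    · rw [G.adj_comm, ← hes]; simp
    · rw [G.adj_comm, ← hft]; dsimp only; constructor <;> intro <;> linarith

/-- As `m` is not adjacent to `t`, its square hovers at a height `f > 0` with `B` in the strip below
it, which keeps the apex free. -/
theorem outerCornerRealizable_series {A B : Finset V} {s m t : V} (hd : Disjoint A B) (hmA : m ∉ A)
    (hmB : m ∉ B) (hAB : ∀ a ∈ A, ∀ b ∈ B, ¬ G.Adj a b) (hAt : ∀ a ∈ A, ¬ G.Adj a t)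
    (hBs : ∀ b ∈ B, ¬ G.Adj b s) (hA : GapRealizable G A s m)
    (hA' : G.Adj s m → TwoCornerRealizable G A s m) (hB : GapRealizable G B t m)
    (htm : ¬ G.Adj t m) : OuterCornerRealizable G (insert m (A ∪ B)) s t := by
  obtain ⟨f, hf, hf', hB⟩ := hB.atSide (d := 1 / 4) (by norm_num)
  -- With `d = f / 2`, chosen after `f`, the network `A` protrudes below the square of `m` by at
  -- most `f / 2` and so stays above height `f / 4`.
  obtain ⟨e, he, he', hes, hA⟩ := exists_atSide hA hA' (d := f / 2) (by linarith) (by linarith)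
  have hA2 : Realizable G A (fun w p => p.x + p.r ≤ 1 / 8 ∧ (InCorner G s t 3 w p ∧
      (f / 4 < p.x - p.r ∨ f / 4 < p.y - p.r)) ∧
      ContactIff (G.Adj w m) p ⟨e + 1, f + 1, 1⟩) := by
    have hsim := similarity_affine (c := 1) (d := 1) 0 (f + 1) (by simp) (by simp)
    refine hA.map hsim ?_
    rintro w hw p hp ⟨h1, h2, h3, h4, h5⟩
    have := hsim.contact _ _ _ h5
    have hy := abs_le.1 (show |p.y| ≤ 1 + f / 2 - p.r by linarith)
    simp only [InCorner, CSquare.affine, abs_one, one_mul, add_zero, zero_add] at this ⊢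
    refine ⟨by linarith, ⟨⟨by linarith, by linarith, by linarith, by linarith, h4, ?_⟩,
      Or.inr (by linarith)⟩, this⟩
    simp only [hAt w hw, iff_false]; intro; linarith
  have hB2 : Realizable G B (fun w p => 1 / 2 ≤ p.x - p.r ∧ (InCorner G s t 3 w p ∧
      (f / 4 < p.x - p.r ∨ f / 4 < p.y - p.r)) ∧
      ContactIff (G.Adj w m) p ⟨e + 1, f + 1, 1⟩) := by
    have hsim := similarity_affine (c := 1) (d := 1) 0 (e + 1) (by simp) (by simp)
    -- The strip is arranged with `t` as the vertical line, then the coordinates are exchanged.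
    refine (hB.map hsim (Q' := fun w p => 1 / 2 ≤ p.y - p.r ∧ (InCorner G t s 3 w p ∧
      (f / 4 < p.y - p.r)) ∧ ContactIff (G.Adj w m) p ⟨f + 1, e + 1, 1⟩) ?_).map similarity_swap ?_
    · rintro w hw p hp ⟨h1, h2, h3, h4, h5⟩
      have := hsim.contact _ _ _ h5
      have hy := abs_le.1 (show |p.y| ≤ 1 / 2 - p.r by linarith)
      simp only [InCorner, CSquare.affine, abs_one, one_mul, add_zero, zero_add] at this ⊢
      refine ⟨by linarith, ⟨⟨by linarith, by linarith, by linarith, by linarith, h4, ?_⟩,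
        by linarith⟩, this⟩
      simp only [hBs w hw, iff_false]; intro; linarith
    · rintro w hw p hp ⟨h0, ⟨⟨h1, h2, h3, h4, h5, h6⟩, h7⟩, h8⟩
      exact ⟨h0, ⟨⟨h3, h4, h1, h2, h6, h5⟩, Or.inl h7⟩, similarity_swap.contact _ _ _ h8⟩
  refine ⟨3, f / 4, by norm_num, by positivity, hA2.series hB2 (p := ⟨e + 1, f + 1, 1⟩)
    hd hmA hmB ?_ one_pos ?_ ?_ ?_⟩
  · rintro a ha b hb p q hp hq ⟨h1, -⟩ ⟨h6, -⟩
    exact contactIff_of_lt_x (hAB a ha b hb) (by linarith)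
  · exact fun w hw p hp h => h.2
  · exact fun w hw p hp h => h.2
  · refine ⟨⟨by simpa, by dsimp only; linarith, by simpa using hf.le, by dsimp only; linarith,
      ?_, ?_⟩, Or.inr (by dsimp only; linarith)⟩
    · rw [G.adj_comm, ← hes]; simp
    · rw [G.adj_comm]; simp [htm, hf.ne']

/-- The square `[0, 2] × [0, 2]` of `m` sits at the apex. This leaves one corner above it for `A`,
at `(0, 2)`, and one to its right for `B`, at `(2, 0)`. -/
theorem cornerRealizable_triangle {A B : Finset V} {s m t : V} (hd : Disjoint A B) (hmA : m ∉ A)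
    (hmB : m ∉ B) (hAB : ∀ a ∈ A, ∀ b ∈ B, ¬ G.Adj a b) (hAt : ∀ a ∈ A, ¬ G.Adj a t)
    (hBs : ∀ b ∈ B, ¬ G.Adj b s) (hA : CornerRealizable G A s m) (hB : CornerRealizable G B m t)
    (hsm : G.Adj s m) (htm : G.Adj t m) : CornerRealizable G (insert m (A ∪ B)) s t := by
  have hA2 : Realizable G A (fun w p => p.x + p.r ≤ 1 ∧ InCorner G s t 3 w p ∧
      ContactIff (G.Adj w m) p ⟨1, 1, 1⟩) := by
    refine (hA.scale one_pos).map (similarity_affine (c := 1) (d := 1) 0 2 (by simp) rfl) ?_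
    rintro w hw p hp ⟨h1, h2, h3, h4, h5, h6⟩
    simp only [InCorner, CSquare.affine, abs_one, one_mul, add_zero]
    refine ⟨h2, ⟨h1, by linarith, by linarith, by linarith, h5, ?_⟩,
      similarity_swap.contact _ ⟨p.y + 2, p.x, p.r⟩ ⟨1, 1, 1⟩ (contactIff_left ?_ ?_ ?_)⟩
    · simp only [hAt w hw, iff_false]; intro; linarith
    · dsimp only; linarith
    · dsimp only; rw [← h6]; constructor <;> intro <;> linarith
    · dsimp only; exact abs_lt.2 ⟨by linarith, by linarith⟩
  have hB2 : Realizable G B (fun w p => 2 ≤ p.x - p.r ∧ InCorner G s t 3 w p ∧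
      ContactIff (G.Adj w m) p ⟨1, 1, 1⟩) := by
    refine (hB.scale one_pos).map (similarity_affine (c := 1) (d := 1) 2 0 (by simp) rfl) ?_
    rintro w hw p hp ⟨h1, h2, h3, h4, h5, h6⟩
    simp only [InCorner, CSquare.affine, abs_one, one_mul, add_zero]
    refine ⟨by linarith, ⟨by linarith, by linarith, by linarith, by linarith, ?_, h6⟩,
      contactIff_left ?_ ?_ ?_⟩
    · simp only [hBs w hw, iff_false]; intro; linarith
    · dsimp only; linarith
    · dsimp only; rw [← h5]; constructor <;> intro <;> linarith
    · dsimp only; exact abs_lt.2 ⟨by linarith, by linarith⟩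
  refine ⟨3, by norm_num, hA2.series hB2 (p := ⟨1, 1, 1⟩) hd hmA hmB ?_ one_pos ?_ ?_ ?_⟩
  · rintro a ha b hb p q hp hq ⟨h1, -⟩ ⟨h6, -⟩
    exact contactIff_of_lt_x (hAB a ha b hb) (by linarith)
  · exact fun w hw p hp h => h.2
  · exact fun w hw p hp h => h.2
  · norm_num [InCorner, hsm.symm, htm.symm]

/-! ### Networks and the main induction -/

/-- `IsNet G I s t`: the graph `G` induced on `I ∪ {s, t}`, with the edge `st` disregarded, is
obtained by series and parallel compositions, where `I` is the set of inner vertices. -/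
inductive IsNet (G : SimpleGraph V) : Finset V → V → V → Prop
  | empty (s t : V) : IsNet G ∅ s t
  | series {A B : Finset V} {s m t : V} (hA : IsNet G A s m) (hB : IsNet G B m t)
      (hd : Disjoint A B) (hmA : m ∉ A) (hmB : m ∉ B) (htA : t ∉ A) (hsB : s ∉ B)
      (hAB : ∀ a ∈ A, ∀ b ∈ B, ¬ G.Adj a b) (hAt : ∀ a ∈ A, ¬ G.Adj a t)
      (hBs : ∀ b ∈ B, ¬ G.Adj b s) : IsNet G (insert m (A ∪ B)) s t
  | parallel {A B : Finset V} {s t : V} (hA : IsNet G A s t) (hB : IsNet G B s t)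
      (hd : Disjoint A B) (hAB : ∀ a ∈ A, ∀ b ∈ B, ¬ G.Adj a b) : IsNet G (A ∪ B) s t

variable [DecidableRel G.Adj]

/-- The common neighbours of `u` and `v` in `I`. -/
def commonIn (G : SimpleGraph V) [DecidableRel G.Adj] (I : Finset V) (u v : V) : Finset V :=
  I.filter fun w => G.Adj w u ∧ G.Adj w v

theorem card_commonIn_union {A B : Finset V} (hd : Disjoint A B) (u v : V) :
    (commonIn G (A ∪ B) u v).card = (commonIn G A u v).card + (commonIn G B u v).card := by
  rw [commonIn, Finset.filter_union]
  exact Finset.card_union_of_disjoint (Finset.disjoint_filter_filter hd)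

/-- All four placements are proved together, since series composition uses gaps and corners of its
parts, and parallel composition in a corner needs the version with free apex. -/
theorem IsNet.realizable (h3 : ∀ u v (T : Finset V), G.Adj u v →
      (∀ w ∈ T, G.Adj w u ∧ G.Adj w v) → T.card ≤ 2) {I : Finset V} {s t : V}
    (h : IsNet G I s t) :
    GapRealizable G I s t ∧
    (G.Adj s t → (commonIn G I s t).card = 0 → OuterCornerRealizable G I s t) ∧
    (G.Adj s t → (commonIn G I s t).card ≤ 1 → CornerRealizable G I s t) ∧
    (G.Adj s t → TwoCornerRealizable G I s t) := by
  have hle : ∀ {u v} (I : Finset V), G.Adj u v → (commonIn G I u v).card ≤ 2 := fun I huv =>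
    h3 _ _ _ huv fun w hw => (Finset.mem_filter.1 hw).2
  induction h with
  | empty s t =>
    have hc : CornerRealizable G ∅ s t := ⟨1, one_pos, realizable_empty _⟩
    exact ⟨⟨1, 1, one_pos, one_pos, realizable_empty _⟩,
      fun _ _ => ⟨1, 1, one_pos, one_pos, realizable_empty _⟩, fun _ _ => hc,
      fun _ => ⟨∅, ∅, by simp, by simp, by simp, hc, hc⟩⟩
  | @series A B s m t hA hB hd hmA hmB htA hsB hAB hAt hBs ihA ihB =>
    obtain ⟨gA, -, cA, tA⟩ := ihA
    obtain ⟨gB, -, cB, tB⟩ := ihB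
    have tB' : G.Adj t m → TwoCornerRealizable G B t m := fun h => (tB h.symm).symm
    have outer : ¬ (G.Adj s m ∧ G.Adj t m) → OuterCornerRealizable G (insert m (A ∪ B)) s t := by
      intro h
      by_cases htm : G.Adj t m
      · rw [Finset.union_comm]
        exact (outerCornerRealizable_series hd.symm hmB hmA
          (fun b hb a ha h => hAB a ha b hb h.symm) hBs hAt gB.symm tB' gA
          (fun hsm => h ⟨hsm, htm⟩)).symm
      · exact outerCornerRealizable_series hd hmA hmB hAB hAt hBs gA tA gB.symm htm
    -- Only `m` can be a common neighbour of `s` and `t` here, so one corner always suffices and the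
    -- second may stay empty.
    have corner : G.Adj s t → CornerRealizable G (insert m (A ∪ B)) s t := by
      intro hst
      by_cases h : G.Adj s m ∧ G.Adj t m
      · obtain ⟨hsm, htm⟩ := h
        refine cornerRealizable_triangle hd hmA hmB hAB hAt hBs (cA hsm ?_) (cB htm.symm ?_)
          hsm htm
        -- `t` is a common neighbour of `s` and `m` outside `A`, leaving at most one inside.
        · have := h3 s m (insert t (commonIn G A s m)) hsm (by
            intro w hw
            rcases Finset.mem_insert.1 hw with rfl | hw
            · exact ⟨hst.symm, htm⟩
            · exact (Finset.mem_filter.1 hw).2)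
          rw [Finset.card_insert_of_notMem (mt (Finset.mem_of_mem_filter t) htA : t ∉ commonIn G A s m)] at this
          omega
        · have := h3 m t (insert s (commonIn G B m t)) htm.symm (by
            intro w hw
            rcases Finset.mem_insert.1 hw with rfl | hw
            · exact ⟨hsm, hst⟩
            · exact (Finset.mem_filter.1 hw).2)
          rw [Finset.card_insert_of_notMem (mt (Finset.mem_of_mem_filter s) hsB : s ∉ commonIn G B m t)] at this
          omega
      · exact (outer h).corner
    refine ⟨gapRealizable_series hd hmA hmB hAB hAt hBs gA tA gB.symm tB', ?_,
      fun hst _ => corner hst,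
      fun hst => ⟨_, ∅, by simp, by simp, by simp, corner hst, 1, one_pos, realizable_empty _⟩⟩
    intro hst h0
    refine outer fun h => ?_
    have : m ∈ commonIn G (insert m (A ∪ B)) s t := by simp [commonIn, h.1.symm, h.2.symm]
    rw [Finset.card_eq_zero.1 h0] at this
    simp at this
  | @parallel A B s t hA hB hd hAB ihA ihB =>
    obtain ⟨gA, oA, cA, tA⟩ := ihA
    obtain ⟨gB, oB, cB, tB⟩ := ihB
    have hBA : ∀ b ∈ B, ∀ a ∈ A, ¬ G.Adj b a := fun b hb a ha h => hAB a ha b hb h.symm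
    rw [card_commonIn_union hd]
    refine ⟨gA.union gB hd hAB, fun hst h => ?_, fun hst h => ?_, fun hst => ?_⟩
    · exact (oA hst (by omega)).union (oB hst (by omega)) hd hAB
    -- At most one part has a common neighbour; that part goes to the apex.
    · by_cases hB0 : (commonIn G B s t).card = 0
      · exact (cA hst (by omega)).union (oB hst hB0) hd hAB
      · rw [Finset.union_comm]
        exact (cB hst (by omega)).union (oA hst (by omega)) hd.symm hBA
    · have h2 := hle (A ∪ B) hst
      rw [card_commonIn_union hd] at h2
      -- A part without common neighbours is wrapped around one of the two corners of the other
      -- part. Otherwise each part has exactly one and takes a corner of its own.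
      by_cases hB0 : (commonIn G B s t).card = 0
      · obtain ⟨C, D, rfl, hCD, hadj, hC, hD⟩ := tA hst
        obtain ⟨hdC, hdD⟩ := Finset.disjoint_union_left.1 hd
        refine ⟨C, D ∪ B, (Finset.union_assoc _ _ _).symm, ?_, ?_, hC,
          hD.union (oB hst hB0) hdD fun a ha b hb => hAB a (by simp [ha]) b hb⟩
        · exact Finset.disjoint_union_right.2 ⟨hCD, hdC⟩
        · intro a ha b hb
          rcases Finset.mem_union.1 hb with hb | hb
          · exact hadj a ha b hb
          · exact hAB a (by simp [ha]) b hb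
      · by_cases hA0 : (commonIn G A s t).card = 0
        · obtain ⟨C, D, rfl, hCD, hadj, hC, hD⟩ := tB hst
          obtain ⟨hdC, hdD⟩ := Finset.disjoint_union_right.1 hd
          refine ⟨C ∪ A, D, ?_, ?_, ?_,
            hC.union (oA hst hA0) hdC.symm fun a ha b hb => hBA a (by simp [ha]) b hb, hD⟩
          · rw [Finset.union_comm C A, Finset.union_assoc]
          · exact Finset.disjoint_union_left.2 ⟨hCD, hdD⟩
          · intro a ha b hb
            rcases Finset.mem_union.1 ha with ha | ha
            · exact hadj a ha b hb
            · exact hAB a ha b (by simp [hb])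
        · exact ⟨A, B, rfl, hd, hAB, cA hst (by omega), cB hst (by omega)⟩

/-- A network together with an edge joining its terminals is realizable. -/
theorem IsNet.exists_squares (h3 : ∀ u v (T : Finset V), G.Adj u v →
      (∀ w ∈ T, G.Adj w u ∧ G.Adj w v) → T.card ≤ 2) {I : Finset V} {s t : V}
    (h : IsNet G I s t) (hst : G.Adj s t) (hsI : s ∉ I) (htI : t ∉ I) :
    Realizable G (insert s (insert t I)) (fun _ _ => True) := by
  have hI := ((h.realizable h3).2.2.2 hst).atSide one_pos le_rfl
  rw [Finset.insert_eq, Finset.insert_eq]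
  -- The right side of this square lies on `x = 0`; half-side `10` exceeds the height `1 + d = 2`
  -- reached by the network.
  have hs : Realizable G {s} (fun _ q => q = ⟨-10, 0, 10⟩) :=
    realizable_singleton _ (by norm_num) rfl
  have ht : Realizable G {t} (fun _ q => q = ⟨0 + 1, 0, 1⟩) :=
    realizable_singleton _ (by norm_num) rfl
  refine hs.union (ht.union hI (Q := fun w p => ContactIff (G.Adj w s) p ⟨-10, 0, 10⟩)
    (by simpa) ?_ ?_ ?_) (by simp [hsI, hst.ne]) ?_ (by simp) (by simp)
  · rintro w hw z hz p q hp hq rfl ⟨-, -, -, -, h5⟩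
    rw [Finset.mem_singleton.1 hw]
    exact h5.symm (G.adj_comm _ _)
  · rintro w hw p hp rfl
    rw [Finset.mem_singleton.1 hw]
    apply contactIff_left <;> norm_num [hst.symm]
  · rintro w hw p hp ⟨h1, h2, h3, h4, h5⟩
    apply contactIff_left
    · dsimp only; linarith
    · dsimp only; rw [← h4]; constructor <;> intro <;> linarith
    · dsimp only; rw [sub_zero]; linarith
  · rintro w hw z hz p q hp hq rfl h
    rw [Finset.mem_singleton.1 hw]
    exact h.symm (G.adj_comm _ _)

end Nets

/-! ### From series-parallel subgraphs to networks -/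

theorem IsTTSP.mem_verts {V : Type*} {G : SimpleGraph V} {H : G.Subgraph} {s t : V}
    (h : IsTTSP H s t) : s ∈ H.verts ∧ t ∈ H.verts ∧ s ≠ t := by
  induction h with
  | edge h => simp [h.ne]
  | @series H₁ H₂ s m t h₁ h₂ hv ih₁ ih₂ =>
    refine ⟨Or.inl ih₁.1, Or.inr ih₂.2.1, ?_⟩
    rintro rfl
    have : s ∈ H₁.verts ∩ H₂.verts := ⟨ih₁.1, ih₂.2.1⟩
    rw [hv] at this
    exact ih₁.2.2 this
  | parallel h₁ h₂ hv hs ih₁ ih₂ => exact ⟨Or.inl ih₁.1, Or.inl ih₁.2.1, ih₁.2.2⟩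

/-- A two-terminal series-parallel subgraph that is induced, up to the edge between its terminals,
is a network. -/
theorem IsTTSP.isNet {V : Type*} [DecidableEq V] {G : SimpleGraph V} {H : G.Subgraph} {s t : V}
    (h : IsTTSP H s t) (hind : ∀ a ∈ H.verts, ∀ b ∈ H.verts, G.Adj a b →
      H.Adj a b ∨ (a = s ∧ b = t) ∨ (a = t ∧ b = s)) :
    ∃ I : Finset V, (∀ a, a ∈ I ↔ a ∈ H.verts ∧ a ≠ s ∧ a ≠ t) ∧ IsNet G I s t := by
  induction h with
  | @edge s t h =>
    refine ⟨∅, fun a => ?_, .empty s t⟩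
    simp; tauto
  | @series H₁ H₂ s m t h₁ h₂ hv ih₁ ih₂ =>
    obtain ⟨hs₁, hm₁, hsm⟩ := h₁.mem_verts
    obtain ⟨hm₂, ht₂, hmt⟩ := h₂.mem_verts
    have hv' : ∀ a, a ∈ H₁.verts → a ∈ H₂.verts → a = m := fun a h h' => by
      have : a ∈ H₁.verts ∩ H₂.verts := ⟨h, h'⟩
      rw [hv] at this
      exact this
    have key : ∀ a ∈ (H₁ ⊔ H₂).verts, ∀ b ∈ (H₁ ⊔ H₂).verts, G.Adj a b →
      ((a ∈ H₁.verts ∧ b ∈ H₁.verts ∧ H₁.Adj a b) ∨ (a ∈ H₂.verts ∧ b ∈ H₂.verts ∧ H₂.Adj a b)) ∨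
        (a = s ∧ b = t) ∨ (a = t ∧ b = s) := fun a ha b hb hab =>
      (hind a ha b hb hab).imp (Or.imp (fun h => ⟨h.fst_mem, h.snd_mem, h⟩)
        (fun h => ⟨h.fst_mem, h.snd_mem, h⟩)) id
    -- Edges of `H₂` have at most one end in `H₁`, and `t` is not in `H₁`, so `H₁` is induced.
    obtain ⟨A, hA, nA⟩ := ih₁ (fun a ha b hb hab => by
      rcases key a (Or.inl ha) b (Or.inl hb) hab with (h | h) | h | h
      · exact Or.inl h.2.2
      · exact absurd ((hv' a ha h.1).trans (hv' b hb h.2.1).symm) hab.ne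
      · exact absurd (hv' t (h.2 ▸ hb) ht₂) hmt.symm
      · exact absurd (hv' t (h.1 ▸ ha) ht₂) hmt.symm)
    obtain ⟨B, hB, nB⟩ := ih₂ (fun a ha b hb hab => by
      rcases key a (Or.inr ha) b (Or.inr hb) hab with (h | h) | h | h
      · exact absurd ((hv' a h.1 ha).trans (hv' b h.2.1 hb).symm) hab.ne
      · exact Or.inl h.2.2
      · exact absurd (hv' s hs₁ (h.1 ▸ ha)) hsm
      · exact absurd (hv' s hs₁ (h.2 ▸ hb)) hsm)
    have ht₁ : t ∉ H₁.verts := fun h => hmt (hv' t h ht₂).symm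
    have hs₂ : s ∉ H₂.verts := fun h => hsm (hv' s hs₁ h)
    have hA₂ : ∀ a ∈ A, a ∉ H₂.verts := fun a ha h =>
      ((hA a).1 ha).2.2 (hv' a ((hA a).1 ha).1 h)
    have hB₁ : ∀ b ∈ B, b ∉ H₁.verts := fun b hb h =>
      ((hB b).1 hb).2.1 (hv' b h ((hB b).1 hb).1)
    refine ⟨insert m (A ∪ B), fun a => ?_, .series nA nB ?_ ?_ ?_ ?_ ?_ ?_ ?_ ?_⟩
    · have h4 : a ∈ (H₁ ⊔ H₂).verts ↔ a ∈ H₁.verts ∨ a ∈ H₂.verts := Iff.rfl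
      rw [Finset.mem_insert, Finset.mem_union, hA, hB, h4]
      constructor
      · rintro (rfl | h | h)
        · exact ⟨Or.inl hm₁, hsm.symm, hmt⟩
        · exact ⟨Or.inl h.1, h.2.1, fun e => ht₁ (e ▸ h.1)⟩
        · exact ⟨Or.inr h.1, fun e => hs₂ (e ▸ h.1), h.2.2⟩
      · rintro ⟨h | h, h1, h2⟩
        · by_cases e : a = m
          · exact Or.inl e
          · exact Or.inr (Or.inl ⟨h, h1, e⟩)
        · by_cases e : a = m
          · exact Or.inl e
          · exact Or.inr (Or.inr ⟨h, e, h2⟩)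
    · exact Finset.disjoint_left.2 fun a ha hb => hA₂ a ha ((hB a).1 hb).1
    · exact fun h => ((hA m).1 h).2.2 rfl
    · exact fun h => ((hB m).1 h).2.1 rfl
    · exact fun h => ht₁ ((hA t).1 h).1
    · exact fun h => hs₂ ((hB s).1 h).1
    · intro a ha b hb hab
      rcases key a (Or.inl ((hA a).1 ha).1) b (Or.inr ((hB b).1 hb).1) hab with (h | h) | h | h
      · exact hB₁ b hb h.2.1
      · exact hA₂ a ha h.1
      · exact ((hA a).1 ha).2.1 h.1
      · exact hs₂ (h.2 ▸ ((hB b).1 hb).1)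
    · intro a ha hab
      rcases key a (Or.inl ((hA a).1 ha).1) t (Or.inr ht₂) hab with (h | h) | h | h
      · exact ht₁ h.2.1
      · exact hA₂ a ha h.1
      · exact ((hA a).1 ha).2.1 h.1
      · exact hA₂ a ha (h.1 ▸ ht₂)
    · intro b hb hab
      rcases key b (Or.inr ((hB b).1 hb).1) s (Or.inl hs₁) hab with (h | h) | h | h
      · exact hB₁ b hb h.1
      · exact hs₂ h.2.1
      · exact hB₁ b hb (h.1 ▸ hs₁)
      · exact ((hB b).1 hb).2.2 h.1
  | @parallel H₁ H₂ s t h₁ h₂ hv hs ih₁ ih₂ =>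
    have hv' : ∀ a, a ∈ H₁.verts → a ∈ H₂.verts → a = s ∨ a = t := fun a h h' => by
      have : a ∈ H₁.verts ∩ H₂.verts := ⟨h, h'⟩
      rw [hv] at this
      exact this
    have key : ∀ a ∈ (H₁ ⊔ H₂).verts, ∀ b ∈ (H₁ ⊔ H₂).verts, G.Adj a b →
      ((a ∈ H₁.verts ∧ b ∈ H₁.verts ∧ H₁.Adj a b) ∨ (a ∈ H₂.verts ∧ b ∈ H₂.verts ∧ H₂.Adj a b)) ∨
        (a = s ∧ b = t) ∨ (a = t ∧ b = s) := fun a ha b hb hab =>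
      (hind a ha b hb hab).imp (Or.imp (fun h => ⟨h.fst_mem, h.snd_mem, h⟩)
        (fun h => ⟨h.fst_mem, h.snd_mem, h⟩)) id
    have two : ∀ a b : V, a ≠ b → (a = s ∨ a = t) → (b = s ∨ b = t) →
        (a = s ∧ b = t) ∨ (a = t ∧ b = s) := by
      rintro a b hab (rfl | rfl) (rfl | rfl) <;> simp_all
    -- An edge of `H₂` with both ends in `H₁` must join `s` and `t`, which is why induced is only
    -- required up to that edge.
    obtain ⟨A, hA, nA⟩ := ih₁ (fun a ha b hb hab => by
      rcases key a (Or.inl ha) b (Or.inl hb) hab with (h | h) | h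
      · exact Or.inl h.2.2
      · exact Or.inr (two a b hab.ne (hv' a ha h.1) (hv' b hb h.2.1))
      · exact Or.inr h)
    obtain ⟨B, hB, nB⟩ := ih₂ (fun a ha b hb hab => by
      rcases key a (Or.inr ha) b (Or.inr hb) hab with (h | h) | h
      · exact Or.inr (two a b hab.ne (hv' a h.1 ha) (hv' b h.2.1 hb))
      · exact Or.inl h.2.2
      · exact Or.inr h)
    have hA₂ : ∀ a ∈ A, a ∉ H₂.verts := fun a ha h =>
      (hv' a ((hA a).1 ha).1 h).elim ((hA a).1 ha).2.1 ((hA a).1 ha).2.2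
    have hB₁ : ∀ b ∈ B, b ∉ H₁.verts := fun b hb h =>
      (hv' b h ((hB b).1 hb).1).elim ((hB b).1 hb).2.1 ((hB b).1 hb).2.2
    refine ⟨A ∪ B, fun a => ?_, .parallel nA nB ?_ ?_⟩
    · have h4 : a ∈ (H₁ ⊔ H₂).verts ↔ a ∈ H₁.verts ∨ a ∈ H₂.verts := Iff.rfl
      rw [Finset.mem_union, hA, hB, h4, or_and_right]
    · exact Finset.disjoint_left.2 fun a ha hb => hA₂ a ha ((hB a).1 hb).1
    · intro a ha b hb hab
      rcases key a (Or.inl ((hA a).1 ha).1) b (Or.inr ((hB b).1 hb).1) hab with (h | h) | h | h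
      · exact hB₁ b hb h.2.1
      · exact hA₂ a ha h.1
      · exact ((hA a).1 ha).2.1 h.1
      · exact ((hA a).1 ha).2.2 h.1

/-! ### The forbidden subgraph -/

/-- In a `K_{1,1,3}`-free graph, adjacent vertices have at most two common neighbours. -/
theorem card_le_two_of_K113_free {V : Type*} {G : SimpleGraph V} (hfree : K113.Free G)
    (u v : V) (T : Finset V) (huv : G.Adj u v) (hT : ∀ w ∈ T, G.Adj w u ∧ G.Adj w v) :
    T.card ≤ 2 := by
  by_contra! hcard
  obtain ⟨a, b, c, ha, hb, hc, hab, hac, hbc⟩ := Finset.two_lt_card_iff.1 hcard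
  apply hfree
  let f : (Σ i : Fin 3, Fin (![1, 1, 3] i)) → V := fun x =>
    if x.1 = 0 then u else if x.1 = 1 then v else
      if x.2.val = 0 then a else if x.2.val = 1 then b else c
  have hua := (hT a ha).1
  have hub := (hT b hb).1
  have huc := (hT c hc).1
  have hva := (hT a ha).2
  have hvb := (hT b hb).2
  have hvc := (hT c hc).2
  refine ⟨⟨⟨f, ?_⟩, ?_⟩⟩
  · rintro ⟨i, j⟩ ⟨k, l⟩ h
    have h' : i ≠ k := h
    simp only [f]
    fin_cases i <;> fin_cases k <;> first | exact absurd rfl h' | skip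
    all_goals simp
    all_goals first | assumption | exact huv.symm | (split_ifs <;> first | assumption | (apply SimpleGraph.Adj.symm; assumption))
  · rintro ⟨i, j⟩ ⟨k, l⟩ h
    change f ⟨i, j⟩ = f ⟨k, l⟩ at h
    have hjl : i = k → j.val = l.val → (⟨i, j⟩ : Σ i : Fin 3, Fin (![1, 1, 3] i)) = ⟨k, l⟩ := by
      rintro rfl h
      rw [Fin.ext h]
    refine hjl ?_ ?_ <;> fin_cases i <;> fin_cases k <;> have hj := j.isLt <;> have hl := l.isLt <;>
      simp [f] at h hj hl ⊢ <;> grind [huv.ne, hua.ne, hub.ne, huc.ne, hva.ne, hvb.ne, hvc.ne]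

/-! ### From centres and half-sides to regions in the plane -/

theorem AxisSquare.interior_region (Q : AxisSquare) :
    interior Q.region = Set.Ioo Q.x (Q.x + Q.side) ×ˢ Set.Ioo Q.y (Q.y + Q.side) := by
  rw [AxisSquare.region, interior_prod_eq, interior_Icc, interior_Icc]

/-- The axis-aligned square with given centre and half-side. -/
def CSquare.toAxisSquare (p : CSquare) (hp : 0 < p.r) : AxisSquare :=
  ⟨p.x - p.r, p.y - p.r, 2 * p.r, by linarith⟩

theorem Apart.region_inter_eq_empty {p q : CSquare} (h : Apart p q) (hp : 0 < p.r) (hq : 0 < q.r) :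
    (p.toAxisSquare hp).region ∩ (q.toAxisSquare hq).region = ∅ := by
  rw [Set.eq_empty_iff_forall_notMem]
  rintro ⟨a, b⟩ ⟨⟨⟨h1, h2⟩, h3, h4⟩, ⟨h5, h6⟩, h7, h8⟩
  simp only [CSquare.toAxisSquare] at h1 h2 h3 h4 h5 h6 h7 h8
  rcases h with h | h <;> rcases lt_abs.1 h with h | h <;> linarith

/-- A common interior point would make both coordinate distances of the centres less than the sum of
the half-sides. -/
theorem Touches.disjoint_interior {p q : CSquare} (h : Touches p q) (hp : 0 < p.r) (hq : 0 < q.r) :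
    Disjoint (interior (p.toAxisSquare hp).region) (interior (q.toAxisSquare hq).region) := by
  rw [AxisSquare.interior_region, AxisSquare.interior_region, Set.disjoint_left]
  rintro ⟨a, b⟩ ⟨⟨h1, h2⟩, h3, h4⟩ ⟨⟨h5, h6⟩, h7, h8⟩
  simp only [CSquare.toAxisSquare] at h1 h2 h3 h4 h5 h6 h7 h8
  have hx : |p.x - q.x| < p.r + q.r := abs_lt.2 ⟨by linarith, by linarith⟩
  have hy : |p.y - q.y| < p.r + q.r := abs_lt.2 ⟨by linarith, by linarith⟩
  rcases h with h | h <;> linarith [h.1]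

/-- The intersection is a product of a nonempty interval in the contact direction and a
nondegenerate interval in the other. -/
theorem Touches.infinite_region_inter {p q : CSquare} (h : Touches p q) (hp : 0 < p.r)
    (hq : 0 < q.r) : ((p.toAxisSquare hp).region ∩ (q.toAxisSquare hq).region).Infinite := by
  have hI : ∀ a b : ℝ, (Set.Icc (a - p.r) (a - p.r + 2 * p.r) ∩
      Set.Icc (b - q.r) (b - q.r + 2 * q.r)) = Set.Icc (max (a - p.r) (b - q.r))
      (min (a - p.r + 2 * p.r) (b - q.r + 2 * q.r)) := fun a b => Set.Icc_inter_Icc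
  have hne : ∀ a b : ℝ, |a - b| = p.r + q.r → (Set.Icc (a - p.r) (a - p.r + 2 * p.r) ∩
      Set.Icc (b - q.r) (b - q.r + 2 * q.r)).Nonempty := fun a b hab => by
    have := abs_le.1 hab.le
    rw [hI, Set.nonempty_Icc]
    exact max_le (le_min (by linarith) (by linarith)) (le_min (by linarith) (by linarith))
  have hinf : ∀ a b : ℝ, |a - b| < p.r + q.r → (Set.Icc (a - p.r) (a - p.r + 2 * p.r) ∩
      Set.Icc (b - q.r) (b - q.r + 2 * q.r)).Infinite := fun a b hab => by
    have := abs_lt.1 hab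
    rw [hI]
    exact Set.Icc_infinite (max_lt (lt_min (by linarith) (by linarith))
      (lt_min (by linarith) (by linarith)))
  simp only [AxisSquare.region, CSquare.toAxisSquare]
  rw [Set.prod_inter_prod]
  rcases h with ⟨h1, h2⟩ | ⟨h1, h2⟩
  · exact (hinf _ _ h2).prod_right (hne _ _ h1)
  · exact (hinf _ _ h2).prod_left (hne _ _ h1)

theorem Realizable.exists_rep {V : Type*} {G : SimpleGraph V} {I : Finset V}
    {Q : V → CSquare → Prop} (h : Realizable G I Q) (hI : ∀ v, v ∈ I) :
    ∃ S : V → AxisSquare, IsProperSquareContactRep G S := by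
  obtain ⟨S, hS, hS'⟩ := h
  have hpos : ∀ v, 0 < (S v).r := fun v => (hS v (hI v)).1
  have hcon : ∀ u v, u ≠ v → ContactIff (G.Adj u v) (S u) (S v) := fun u v huv =>
    hS' u (hI u) v (hI v) huv
  have htouch : ∀ u v : V, u ≠ v →
      ((((S u).toAxisSquare (hpos u)).region ∩ ((S v).toAxisSquare (hpos v)).region).Nonempty ↔
        G.Adj u v) := fun u v huv => by
    by_cases h : G.Adj u v
    · exact iff_of_true (((hcon u v huv).1 h).infinite_region_inter _ _).nonempty h
    · refine iff_of_false ?_ h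
      rw [((hcon u v huv).2 h).region_inter_eq_empty]
      exact Set.not_nonempty_empty
  refine ⟨fun v => (S v).toAxisSquare (hpos v), ⟨fun u v huv => ?_, htouch⟩, fun u v huv h => ?_⟩
  · by_cases h : G.Adj u v
    · exact ((hcon u v huv).1 h).disjoint_interior _ _
    · refine Set.disjoint_of_subset interior_subset interior_subset ?_
      rw [Set.disjoint_iff_inter_eq_empty]
      exact ((hcon u v huv).2 h).region_inter_eq_empty _ _
  · exact ((hcon u v huv).1 ((htouch u v huv).1 h)).infinite_region_inter _ _

theorem theorem2 {V : Type*} [Finite V] (G : SimpleGraph V)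
    (hG : IsSeriesParallel G) (hfree : K113.Free G) :
    ∃ S : V → AxisSquare, IsProperSquareContactRep G S := by
  classical
  have h3 := card_le_two_of_K113_free hfree
  rcases hG with ⟨s, t, h, htop⟩ | ⟨s, t, h, H, hH, -, htop⟩
  -- A single edge is the empty network plus the edge joining its terminals.
  · refine ((IsNet.empty s t).exists_squares h3 h (by simp) (by simp)).exists_rep fun v => ?_
    have : v ∈ (G.subgraphOfAdj h).verts := by rw [htop]; trivial
    simpa using this
  · obtain ⟨hs, ht, -⟩ := hH.mem_verts
    have hind : ∀ a ∈ H.verts, ∀ b ∈ H.verts, G.Adj a b →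
        H.Adj a b ∨ (a = s ∧ b = t) ∨ (a = t ∧ b = s) := by
      intro a _ b _ hab
      have : (H ⊔ G.subgraphOfAdj h).Adj a b := by rw [htop]; exact hab
      rcases this with this | this
      · exact Or.inl this
      · simp at this; tauto
    obtain ⟨I, hI, hnet⟩ := hH.isNet hind
    refine (hnet.exists_squares h3 h (by simp [hI]) (by simp [hI])).exists_rep fun v => ?_
    have : v ∈ (H ⊔ G.subgraphOfAdj h).verts := by rw [htop]; trivial
    rw [Finset.mem_insert, Finset.mem_insert, hI]
    by_cases hvs : v = s
    · exact Or.inl hvs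
    · by_cases hvt : v = t
      · exact Or.inr (Or.inl hvt)
      · rcases this with this | this
        · exact Or.inr (Or.inr ⟨this, hvs, hvt⟩)
        · simp [hvs, hvt] at this
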